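/- Write $\mathbb T^n=\{t^n_j=j2^{-n}: 0\le j\le 2^n\}$ for the $n$-th dyadic partition of $[0,1]$. For $p\in\mathbb N$, $p\ge 1$, and $x\in C([0,1])$ (real-valued) put $$[x]^{(p)}_{\mathbb T^n}(t)=\sum_{j=0}^{2^n-1}\big|x(t^n_{j+1}\wedge t)-x(t^n_j\wedge t)\big|^p,\qquad t\in[0,1].$$ If these converge for every $t$ as $n\to\infty$ to a continuous function of $t$, then $x$ is said to admit finite $p$-th variation, and the limit is denoted $[x]^{(p)}_{\mathbb T}$. **Theorem 3.15 (Continuity of the Föllmer–Itô map, even $p$).** Let $p\ge 2$ be an even integer. Let $x\in C([0,1])$ admit finite $p$-th variation with $[x]^{(p)}_{\mathbb T}(t)=C_pt$ for all $t\in[0,1]$, for some constant $C_p>0$. Let $M>\|x\|_\infty$ and $\bar x:=x+M$, a strictly positive path. Let $(B,\|\cdot\|_B)$ be a real Banach space whose elements are functions in $C([0,1])$ (with pointwise operations), such that every $g\in B$ admits finite $p$-th variation with $[g]^{(p)}_{\mathbb T}\equiv 0$, and such that the embeddings of $B$ into $(C([0,1]),\|\cdot\|_\infty)$ and into $L^p([0,1])$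 are continuous. Let $$\mathcal L_{\bar x}(B)=\{g\bar x: g\in B\},\qquad \|g\bar x\|_{\mathcal L}:=\|g\|_B .$$ Let $f:\mathbb R\to\mathbb R$ be $p$ times continuously differentiable. Then for every $y\in\mathcal L_{\bar x}(B)$ and every $t\in[0,1]$ the limit $$\mathcal I_f(y)(t)=\int_0^t f'(y_u)\,dy_u:=\lim_{n\to\infty}\ \sum_{j:\,t^n_j<t}\ \sum_{k=1}^{p-1}\frac{f^{(k)}\big(y(t^n_j)\big)}{k!}\Big(y(t^n_{j+1}\wedge t)-y(t^n_j\wedge t)\Big)^k$$ exists, the function $\mathcal I_f(y)$ is continuous on $[0,1]$, and the map $\mathcal I_f:\mathcal L_{\bar x}(B)\to C([0,1])$ is continuous from the norm $\|\cdot\|_{\mathcal L}$ to the uniform norm. -/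

import Mathlib

open Filter Topology

/-- The dyadic point `j / 2 ^ n` of `[0,1]` (for `j ≤ 2 ^ n`; larger `j`, never used, are sent to `1`). -/
noncomputable def dyadicPt (n j : ℕ) : unitInterval :=
  Set.projIcc (0 : ℝ) 1 zero_le_one ((j : ℝ) / 2 ^ n)

theorem dyadicPt_coe {n j : ℕ} (hj : j ≤ 2 ^ n) : ((dyadicPt n j : unitInterval) : ℝ) = j / 2 ^ n := by
  have h : (j : ℝ) / 2 ^ n ∈ Set.Icc (0 : ℝ) 1 := by
    refine ⟨by positivity, ?_⟩
    rw [div_le_one (by positivity)]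
    exact_mod_cast hj
  simp [dyadicPt, Set.projIcc_of_mem zero_le_one h]

/-- The `p`-th variation of `x` up to time `t` along the `n`-th dyadic partition. -/
noncomputable def discreteVariation (p : ℕ) (x : C(unitInterval, ℝ)) (n : ℕ) (t : unitInterval) : ℝ :=
  ∑ j ∈ Finset.range (2 ^ n), |x (min (dyadicPt n (j + 1)) t) - x (min (dyadicPt n j) t)| ^ p

/-- `x` admits finite `p`-th variation along the dyadic partition sequence, and its `p`-th variation
is the (continuous) function `v`. -/
def HasPthVariation (p : ℕ) (x : C(unitInterval, ℝ)) (v : unitInterval → ℝ) : Prop :=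
  Continuous v ∧ ∀ t, Tendsto (fun n => discreteVariation p x n t) atTop (𝓝 (v t))

/-- The compensated Riemann sum of order `p - 1` along the `n`-th dyadic partition, up to time `t`. -/
noncomputable def follmerSum (p : ℕ) (f : ℝ → ℝ) (y : C(unitInterval, ℝ)) (n : ℕ)
    (t : unitInterval) : ℝ :=
  ∑ j ∈ (Finset.range (2 ^ n)).filter (fun j => dyadicPt n j < t),
    ∑ k ∈ Finset.Icc 1 (p - 1),
      iteratedDeriv k f (y (dyadicPt n j)) / (k.factorial : ℝ) *
        (y (min (dyadicPt n (j + 1)) t) - y (min (dyadicPt n j) t)) ^ k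

/-- The Föllmer–Itô integral of `f'(y)` against `y` exists on `[0,t]` for every `t`, and, as a function
of `t`, it equals `J`. -/
def IsFollmerItoIntegral (p : ℕ) (f : ℝ → ℝ) (y : C(unitInterval, ℝ)) (J : unitInterval → ℝ) : Prop :=
  ∀ t, Tendsto (fun n => follmerSum p f y n t) atTop (𝓝 (J t))

section Transport

variable {B : Type*} [NormedAddCommGroup B] [NormedSpace ℝ B]

/-- The map `g ↦ g * xb`, where `ι` is the inclusion of `B` into the continuous functions. -/
noncomputable def transportMap (ι : B →ₗ[ℝ] C(unitInterval, ℝ)) (xb : C(unitInterval, ℝ)) :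
    B →ₗ[ℝ] C(unitInterval, ℝ) where
  toFun g := ι g * xb
  map_add' g h := by rw [map_add, add_mul]
  map_smul' c g := by rw [map_smul, smul_mul_assoc, RingHom.id_apply]

/-- The transported space `{g * xb : g ∈ B}`. -/
noncomputable def transportedSpace (ι : B →ₗ[ℝ] C(unitInterval, ℝ)) (xb : C(unitInterval, ℝ)) :
    Submodule ℝ C(unitInterval, ℝ) :=
  LinearMap.range (transportMap ι xb)

/-- The transported norm: the norm in `B` of the `g` with `y = g * xb`. This `g` is unique when `ι` is
injective and `xb` is positive, see `transportedNorm_eq`. -/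
noncomputable def transportedNorm (ι : B →ₗ[ℝ] C(unitInterval, ℝ)) (xb : C(unitInterval, ℝ))
    (y : transportedSpace ι xb) : ℝ :=
  ‖Classical.choose (LinearMap.mem_range.mp y.2)‖

theorem transportMap_injective {ι : B →ₗ[ℝ] C(unitInterval, ℝ)} {xb : C(unitInterval, ℝ)}
    (hι : Function.Injective ι) (hxb : ∀ t, 0 < xb t) : Function.Injective (transportMap ι xb) := by
  intro g h hgh
  apply hι
  ext t
  have := congrArg (fun u : C(unitInterval, ℝ) => u t) hgh
  simpa [transportMap, (hxb t).ne'] using this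

theorem transportedNorm_eq {ι : B →ₗ[ℝ] C(unitInterval, ℝ)} {xb : C(unitInterval, ℝ)}
    (hι : Function.Injective ι) (hxb : ∀ t, 0 < xb t) (y : transportedSpace ι xb) (g : B)
    (hg : ι g * xb = y) : transportedNorm ι xb y = ‖g‖ := by
  have h := Classical.choose_spec (LinearMap.mem_range.mp y.2)
  have h2 : Classical.choose (LinearMap.mem_range.mp y.2) = g :=
    transportMap_injective hι hxb (h.trans hg.symm)
  rw [transportedNorm, h2]

end Transport

/-!
Write `y = g * xb` with `g ∈ B`. The increment of `y` over a dyadic interval is `g` at the left end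
point times the increment of `xb`, plus a bounded factor times the increment of `g`. As `g` has
vanishing `p`-th variation, the second part does not contribute in the limit
(`tendsto_sum_abs_variation_mul_sub`), so that `y` inherits from `xb` the `p`-th variation
`d[y] = Cp * |g| ^ p dt`, also when it is integrated against a continuous function
(`tendsto_sum_mul_variation`, `tendsto_sum_mul_variation_mul`).

Telescope `f (y t) - f (y 0)` along the dyadic partition and expand every summand by Taylor's formula
of order `p`. The terms of order `1, …, p - 1` form the Föllmer sum, the term of order `p` converges
because `p` is even, and the remainder is `o(1)` times the `p`-th variation
(`uniform_taylor_peano`). This gives the change of variables formula (`tendsto_follmerSum`)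
`∫₀ᵗ f'(y) dy = f (y t) - f (y 0) - (Cp / p!) * ∫₀ᵗ f⁽ᵖ⁾(y u) * |g u| ^ p du`.

The right-hand side, called `itoPath`, is defined for every continuous `g` and depends continuously
on `g` in the uniform norm (`continuous_itoPath`). The transported norm of `y` is the norm of `g` in
`B`, and `B` embeds continuously into the continuous functions, so the claim follows.

All sums are evaluated at the partition points stopped at `t`, `min (dyadicPt n j) t`. Intervals to the
right of `t` then have zero increments, and the sums run over the whole partition.
-/

/-! ### Two estimates for real functions -/

/-- Taylor's formula with Peano remainder, uniformly for base points in a bounded interval. The constant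
term is split off from the polynomial, and so is the term of order `p`. -/
theorem uniform_taylor_peano {p : ℕ} (hp : 0 < p) {f : ℝ → ℝ} (hf : ContDiff ℝ p f) (R : ℝ)
    {η : ℝ} (hη : 0 < η) :
    ∃ δ > 0, ∀ a ∈ Set.Icc (-R) R, ∀ b ∈ Set.Icc (-R) R, |b - a| < δ →
      |f b - f a - ∑ k ∈ Finset.Icc 1 (p - 1), iteratedDeriv k f a / (k.factorial : ℝ) * (b - a) ^ k
        - iteratedDeriv p f a / (p.factorial : ℝ) * (b - a) ^ p| ≤ η * |b - a| ^ p := by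
  have huc : UniformContinuousOn (iteratedDeriv p f) (Set.Icc (-R) R) :=
    isCompact_Icc.uniformContinuousOn_of_continuous
      (hf.continuous_iteratedDeriv p le_rfl).continuousOn
  obtain ⟨δ, hδ, h⟩ := Metric.uniformContinuousOn_iff.mp huc η hη
  refine ⟨δ, hδ, fun a ha b hb hab => ?_⟩
  obtain ⟨n, rfl⟩ : ∃ n, p = n + 1 := ⟨p - 1, by omega⟩
  rcases eq_or_ne a b with rfl | hne
  · have : ∀ k ∈ Finset.Icc 1 (n + 1 - 1),
        iteratedDeriv k f a / (k.factorial : ℝ) * (a - a) ^ k = 0 := by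
      intro k hk
      rw [Finset.mem_Icc] at hk
      simp [show k ≠ 0 by omega]
    rw [Finset.sum_eq_zero this]
    simp
  have hu : UniqueDiffOn ℝ (Set.uIcc a b) := uniqueDiffOn_uIcc hne
  obtain ⟨c, hc, hT⟩ := taylor_mean_remainder_lagrange_iteratedDeriv hne
    (hf.contDiffOn (s := Set.uIcc a b))
  have hcI : c ∈ Set.Icc (-R) R :=
    Set.uIcc_subset_Icc ha hb (Set.uIoo_subset_uIcc_self hc)
  have hca : |c - a| ≤ |b - a| :=
    Set.abs_sub_left_of_mem_uIcc (Set.uIoo_subset_uIcc_self hc)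
  have hTE : taylorWithinEval f n (Set.uIcc a b) a b = f a +
      ∑ k ∈ Finset.Icc 1 n, iteratedDeriv k f a / (k.factorial : ℝ) * (b - a) ^ k := by
    rw [taylor_within_apply, Finset.sum_range_succ', add_comm]
    congr 1
    · simp
    · rw [Finset.sum_bij (fun k _ => k + 1)]
      · intro k hk
        simp only [Finset.mem_range, Finset.mem_Icc] at hk ⊢
        omega
      · intro k _ l _ hkl
        omega
      · intro k hk
        rw [Finset.mem_Icc] at hk
        exact ⟨k - 1, by rw [Finset.mem_range]; omega, by omega⟩
      · intro k hk
        rw [Finset.mem_range] at hk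
        have hk' : ((k + 1 : ℕ) : WithTop ℕ∞) ≤ ((n + 1 : ℕ) : WithTop ℕ∞) := by
          exact_mod_cast (by omega : k + 1 ≤ n + 1)
        rw [iteratedDerivWithin_eq_iteratedDeriv hu (hf.of_le hk').contDiffAt Set.left_mem_uIcc,
          smul_eq_mul]
        ring
  have key : f b - f a - ∑ k ∈ Finset.Icc 1 (n + 1 - 1),
        iteratedDeriv k f a / (k.factorial : ℝ) * (b - a) ^ k
        - iteratedDeriv (n + 1) f a / ((n + 1).factorial : ℝ) * (b - a) ^ (n + 1)
      = (iteratedDeriv (n + 1) f c - iteratedDeriv (n + 1) f a) / ((n + 1).factorial : ℝ)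
        * (b - a) ^ (n + 1) := by
    rw [hTE] at hT
    rw [Nat.add_sub_cancel]
    linear_combination hT
  rw [key, abs_mul, abs_pow, abs_div, Nat.abs_cast]
  gcongr
  have h1 := (h c hcI a ha (by rw [Real.dist_eq]; linarith)).le
  rw [Real.dist_eq] at h1
  refine (div_le_self (abs_nonneg _) ?_).trans h1
  exact_mod_cast (n + 1).factorial_pos

/-- Adding `b` changes `|a| ^ p` by at most a small multiple of `|a| ^ p` plus a large multiple of
`|b| ^ p`. -/
theorem exists_abs_add_pow_sub_pow_le (p : ℕ) {ε : ℝ} (hε : 0 < ε) :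
    ∃ K, 0 ≤ K ∧ ∀ a b : ℝ, |(|a + b| ^ p - |a| ^ p)| ≤ ε * |a| ^ p + K * |b| ^ p := by
  rcases p.eq_zero_or_pos with rfl | hp
  · exact ⟨0, le_rfl, fun a b => by simpa using hε.le⟩
  set δ : ℝ := min 1 (ε / (p * 2 ^ (p - 1))) with hδd
  have hp' : (0 : ℝ) < p := by exact_mod_cast hp
  have hδ : 0 < δ := lt_min one_pos (by positivity)
  have hδ1 : δ ≤ 1 := min_le_left _ _
  have hδ2 : δ * (p * 2 ^ (p - 1)) ≤ ε := by
    rw [← le_div_iff₀ (by positivity)]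
    exact min_le_right _ _
  refine ⟨(1 / δ + 1) ^ p, by positivity, fun a b => ?_⟩
  -- If `|b|` is small compared to `|a|`, use the mean value bound; otherwise `|b| ^ p` dominates.
  rcases le_or_gt |b| (δ * |a|) with h | h
  · have h1 : |(|a + b| - |a|)| ≤ δ * |a| := by
      refine (abs_abs_sub_abs_le_abs_sub _ _).trans ?_
      simpa using h
    have h2 : max |(|a + b|)| |(|a|)| ≤ 2 * |a| := by
      rw [abs_abs, abs_abs]
      have := abs_add_le a b
      have := abs_nonneg a
      exact max_le (by nlinarith) (by linarith)
    calc |(|a + b| ^ p - |a| ^ p)|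
        ≤ |(|a + b| - |a|)| * p * max |(|a + b|)| |(|a|)| ^ (p - 1) := abs_pow_sub_pow_le _ _ _
      _ ≤ δ * |a| * p * (2 * |a|) ^ (p - 1) := by gcongr
      _ = δ * (p * 2 ^ (p - 1)) * |a| ^ p := by
        conv_rhs => rw [← Nat.sub_add_cancel hp, pow_succ |a|]
        rw [mul_pow, Nat.sub_add_cancel hp]
        ring
      _ ≤ ε * |a| ^ p := by gcongr
      _ ≤ _ := by
        have : 0 ≤ (1 / δ + 1) ^ p * |b| ^ p := by positivity
        linarith
  · have h1 : |a| ≤ 1 / δ * |b| := by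
      rw [one_div, ← div_eq_inv_mul, le_div_iff₀ hδ]
      linarith
    have h2 : |a + b| ≤ (1 / δ + 1) * |b| := by
      have := abs_add_le a b
      linarith
    have h3 : |a| ≤ (1 / δ + 1) * |b| := by
      have := abs_nonneg b
      linarith
    have h4 : |a + b| ^ p ≤ (1 / δ + 1) ^ p * |b| ^ p := by
      rw [← mul_pow]; gcongr
    have h5 : |a| ^ p ≤ (1 / δ + 1) ^ p * |b| ^ p := by
      rw [← mul_pow]; gcongr
    have h6 : 0 ≤ |a + b| ^ p := by positivity
    have h7 : 0 ≤ |a| ^ p := by positivity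
    have h8 : 0 ≤ ε * |a| ^ p := by positivity
    rw [abs_le]
    constructor <;> linarith

/-! ### Partition points stopped at a time -/

/-- The dyadic point `j / 2 ^ n` stopped at time `t`. -/
noncomputable def stoppedPt (n j : ℕ) (t : unitInterval) : unitInterval := min (dyadicPt n j) t

/-- The increment of `y`, stopped at time `t`, over the `j`-th interval of the `n`-th dyadic
partition. -/
noncomputable def stoppedIncr (y : C(unitInterval, ℝ)) (n j : ℕ) (t : unitInterval) : ℝ :=
  y (stoppedPt n (j + 1) t) - y (stoppedPt n j t)

theorem discreteVariation_eq_sum_stoppedIncr (p : ℕ) (x : C(unitInterval, ℝ)) (n : ℕ)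
    (t : unitInterval) :
    discreteVariation p x n t = ∑ j ∈ Finset.range (2 ^ n), |stoppedIncr x n j t| ^ p := rfl

theorem dyadicPt_mono (n : ℕ) : Monotone (dyadicPt n) := fun i j h => by
  apply Set.monotone_projIcc
  gcongr

theorem dyadicPt_zero (n : ℕ) : dyadicPt n 0 = 0 :=
  Subtype.ext (by rw [dyadicPt_coe (Nat.zero_le _)]; simp)

theorem dyadicPt_two_pow (n : ℕ) : dyadicPt n (2 ^ n) = 1 :=
  Subtype.ext (by rw [dyadicPt_coe le_rfl]; simp)

theorem dyadicPt_refine (m l i : ℕ) : dyadicPt (m + l) (i * 2 ^ l) = dyadicPt m i := by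
  unfold dyadicPt
  congr 1
  push_cast
  rw [pow_add, mul_div_mul_right _ _ (by positivity)]

theorem stoppedPt_mono (n : ℕ) (t : unitInterval) : Monotone fun j => stoppedPt n j t :=
  fun _ _ h => min_le_min_right t (dyadicPt_mono n h)

theorem stoppedPt_zero (n : ℕ) (t : unitInterval) : stoppedPt n 0 t = 0 := by
  rw [stoppedPt, dyadicPt_zero]
  exact min_eq_left t.2.1

theorem stoppedPt_two_pow (n : ℕ) (t : unitInterval) : stoppedPt n (2 ^ n) t = t := by
  rw [stoppedPt, dyadicPt_two_pow]
  exact min_eq_right t.2.2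

theorem dist_stoppedPt_le (n i r : ℕ) (t : unitInterval) :
    dist (stoppedPt n (i + r) t) (stoppedPt n i t) ≤ r / 2 ^ n := by
  have hmin : ∀ a : unitInterval, ((min a t : unitInterval) : ℝ) = min (a : ℝ) t := fun a =>
    (Subtype.mono_coe _).map_min
  rw [Subtype.dist_eq, Real.dist_eq, stoppedPt, stoppedPt, hmin, hmin]
  refine (abs_inf_sub_inf_le_abs _ _ _).trans ?_
  refine (Set.abs_projIcc_sub_projIcc zero_le_one).trans (le_of_eq ?_)
  rw [← sub_div, Nat.cast_add, add_sub_cancel_left, abs_of_nonneg (by positivity)]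

theorem stoppedIncr_eq_zero (y : C(unitInterval, ℝ)) {n j : ℕ} {t : unitInterval}
    (h : t ≤ dyadicPt n j) : stoppedIncr y n j t = 0 := by
  rw [stoppedIncr, stoppedPt, stoppedPt, min_eq_right h,
    min_eq_right (h.trans (dyadicPt_mono n j.le_succ)), sub_self]

theorem eventually_abs_stoppedIncr_lt (y : C(unitInterval, ℝ)) {δ : ℝ} (hδ : 0 < δ) :
    ∀ᶠ n in atTop, ∀ j t, |stoppedIncr y n j t| < δ := by
  obtain ⟨η, hη, h⟩ := Metric.uniformContinuous_iff.mp
    (CompactSpace.uniformContinuous_of_continuous y.continuous) δ hδ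
  have hlim : Tendsto (fun n : ℕ => (1 / 2 : ℝ) ^ n) atTop (𝓝 0) :=
    tendsto_pow_atTop_nhds_zero_of_lt_one (by norm_num) (by norm_num)
  filter_upwards [hlim.eventually_lt_const hη] with n hn j t
  refine h ((dist_stoppedPt_le n j 1 t).trans_lt ?_)
  simpa using hn

theorem sum_range_mul_eq (F : ℕ → ℝ) (a b : ℕ) :
    ∑ j ∈ Finset.range (a * b), F j
      = ∑ i ∈ Finset.range a, ∑ r ∈ Finset.range b, F (i * b + r) := by
  induction a with
  | zero => simp
  | succ a ih => rw [Nat.succ_mul, Finset.sum_range_add, ih, Finset.sum_range_succ]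

/-- Up to a stopped point of level `m`, the variation of a finer level is the sum over the intervals
to the left of that point. -/
theorem discreteVariation_stoppedPt {p : ℕ} (hp : p ≠ 0) (x : C(unitInterval, ℝ)) {m i : ℕ}
    (hi : i ≤ 2 ^ m) (l : ℕ) (t : unitInterval) :
    discreteVariation p x (m + l) (stoppedPt m i t)
      = ∑ j ∈ Finset.range (i * 2 ^ l), |stoppedIncr x (m + l) j t| ^ p := by
  have hle : i * 2 ^ l ≤ 2 ^ (m + l) := by rw [pow_add]; gcongr
  rw [discreteVariation_eq_sum_stoppedIncr,
    ← Finset.sum_subset (Finset.range_subset_range.mpr hle)]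
  · refine Finset.sum_congr rfl fun j hj => ?_
    rw [Finset.mem_range] at hj
    have h : ∀ k ≤ i * 2 ^ l, stoppedPt (m + l) k (stoppedPt m i t) = stoppedPt (m + l) k t := by
      intro k hk
      have := dyadicPt_mono (m + l) hk
      rw [dyadicPt_refine] at this
      rw [stoppedPt, stoppedPt, stoppedPt, ← min_assoc, min_eq_left this]
    rw [stoppedIncr, stoppedIncr, h _ hj, h _ hj.le]
  · intro j _ hj
    rw [Finset.mem_range, not_lt] at hj
    have := dyadicPt_mono (m + l) hj
    rw [dyadicPt_refine] at this
    rw [stoppedIncr_eq_zero x (t := stoppedPt m i t) ((min_le_left _ _).trans this), abs_zero,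
      zero_pow hp]

/-! ### Primitives of continuous functions on the unit interval -/

/-- The primitive `t ↦ ∫₀ᵗ φ` of a continuous function on `[0,1]`; the integrand is extended to the
real line by its values at the end points. -/
noncomputable def pathPrimitive (φ : C(unitInterval, ℝ)) : C(unitInterval, ℝ) where
  toFun t := ∫ u in (0 : ℝ)..t, φ (Set.projIcc 0 1 zero_le_one u)
  continuous_toFun :=
    (intervalIntegral.continuous_primitive (fun a b => Continuous.intervalIntegrable
      (φ.continuous.comp continuous_projIcc) a b) 0).comp continuous_subtype_val

theorem intervalIntegrable_projIcc (φ : C(unitInterval, ℝ)) (a b : ℝ) :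
    IntervalIntegrable (fun u => φ (Set.projIcc 0 1 zero_le_one u)) MeasureTheory.volume a b :=
  (φ.continuous.comp continuous_projIcc).intervalIntegrable a b

theorem pathPrimitive_apply (φ : C(unitInterval, ℝ)) (t : unitInterval) :
    pathPrimitive φ t = ∫ u in (0 : ℝ)..t, φ (Set.projIcc 0 1 zero_le_one u) := rfl

theorem continuous_pathPrimitive : Continuous pathPrimitive := by
  refine LipschitzWith.continuous (K := 1) (LipschitzWith.of_dist_le_mul fun φ ψ => ?_)
  rw [NNReal.coe_one, one_mul, ContinuousMap.dist_le dist_nonneg]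
  intro t
  rw [Real.dist_eq, pathPrimitive_apply, pathPrimitive_apply,
    ← intervalIntegral.integral_sub (intervalIntegrable_projIcc φ _ _)
      (intervalIntegrable_projIcc ψ _ _), ← Real.norm_eq_abs]
  refine (intervalIntegral.norm_integral_le_of_norm_le_const (C := dist φ ψ) fun u _ => ?_).trans ?_
  · rw [← dist_eq_norm]
    exact ContinuousMap.dist_apply_le_dist _
  · rw [sub_zero, abs_of_nonneg t.2.1]
    exact mul_le_of_le_one_right dist_nonneg t.2.2

theorem abs_pathPrimitive_sub_le (φ : C(unitInterval, ℝ)) {a b : unitInterval} (hab : a ≤ b)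
    {ε : ℝ} (h : ∀ s, a ≤ s → s ≤ b → |φ s - φ a| ≤ ε) :
    |pathPrimitive φ b - pathPrimitive φ a - φ a * (b - a)| ≤ ε * (b - a) := by
  have h1 : pathPrimitive φ b - pathPrimitive φ a - φ a * (b - a)
      = ∫ u in (a : ℝ)..b, (φ (Set.projIcc 0 1 zero_le_one u) - φ a) := by
    rw [intervalIntegral.integral_sub (intervalIntegrable_projIcc φ _ _) (by simp),
      intervalIntegral.integral_const, smul_eq_mul, mul_comm (φ a), pathPrimitive_apply,
      pathPrimitive_apply, intervalIntegral.integral_interval_sub_left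
        (intervalIntegrable_projIcc φ _ _) (intervalIntegrable_projIcc φ _ _)]
  have hab' : (a : ℝ) ≤ b := hab
  rw [h1, ← abs_of_nonneg (sub_nonneg.mpr hab'), ← Real.norm_eq_abs]
  refine intervalIntegral.norm_integral_le_of_norm_le_const fun u hu => ?_
  rw [Set.uIoc_of_le hab'] at hu
  have hu1 : u ∈ Set.Icc (0 : ℝ) 1 := ⟨a.2.1.trans hu.1.le, hu.2.trans b.2.2⟩
  rw [Set.projIcc_of_mem zero_le_one hu1]
  exact h _ hu.1.le hu.2

/-! ### Sums weighted by the variation -/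

/-- If `x` has `p`-th variation `C * t`, the discrete measures with the masses `|Δx| ^ p` converge
weakly to `C` times Lebesgue measure: on the blocks of a fixed level `m` the weight `φ` is almost
constant, and the mass of a block is a difference of variations of `x`. -/
theorem tendsto_sum_mul_variation {p : ℕ} (hp : p ≠ 0) {x : C(unitInterval, ℝ)} {C : ℝ}
    (hC : 0 ≤ C) (hx : HasPthVariation p x fun t => C * (t : ℝ)) (φ : C(unitInterval, ℝ))
    (t : unitInterval) :
    Tendsto (fun n => ∑ j ∈ Finset.range (2 ^ n),
      φ (stoppedPt n j t) * |stoppedIncr x n j t| ^ p) atTop (𝓝 (C * pathPrimitive φ t)) := by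
  rw [Metric.tendsto_nhds]
  intro ε' hε'
  -- The three terms are the errors of the weighted sum, of the block masses and of the integral.
  obtain ⟨ε, hε, hεε'⟩ : ∃ ε > 0, ε * (C + 1) + ε + ε * C < ε' := by
    refine ⟨ε' / (2 * (2 * C + 2)), by positivity, ?_⟩
    have : ε' / (2 * (2 * C + 2)) * (C + 1) + ε' / (2 * (2 * C + 2)) + ε' / (2 * (2 * C + 2)) * C
      = ε' / 2 := by field_simp; ring
    rw [this]
    linarith
  obtain ⟨η, hη, hφ⟩ := Metric.uniformContinuous_iff.mp
    (CompactSpace.uniformContinuous_of_continuous φ.continuous) ε hε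
  obtain ⟨m, hm⟩ : ∃ m : ℕ, (1 / 2 : ℝ) ^ m < η := exists_pow_lt_of_lt_one hη (by norm_num)
  set s : ℕ → unitInterval := fun i => stoppedPt m i t with hs
  have hs_dist : ∀ i, dist (s (i + 1)) (s i) < η := fun i =>
    (dist_stoppedPt_le m i 1 t).trans_lt (by simpa using hm)
  have hV : ∀ u, Tendsto (fun l => discreteVariation p x (m + l) u) atTop (𝓝 (C * (u : ℝ))) :=
    fun u => (hx.2 u).comp (tendsto_atTop_mono (fun l => Nat.le_add_left l m) tendsto_id)
  -- With the weight frozen at the left end of each block, convergence is that of finitely many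
  -- variations.
  have hmid : Tendsto (fun l => ∑ i ∈ Finset.range (2 ^ m), φ (s i) *
      (discreteVariation p x (m + l) (s (i + 1)) - discreteVariation p x (m + l) (s i))) atTop
      (𝓝 (∑ i ∈ Finset.range (2 ^ m), φ (s i) * (C * (s (i + 1) : ℝ) - C * (s i : ℝ)))) :=
    tendsto_finsetSum _ fun i _ => ((hV _).sub (hV _)).const_mul _
  have hint : |∑ i ∈ Finset.range (2 ^ m), φ (s i) * (C * (s (i + 1) : ℝ) - C * (s i : ℝ))
      - C * pathPrimitive φ t| ≤ ε * C := by
    have htel : pathPrimitive φ t = ∑ i ∈ Finset.range (2 ^ m),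
        (pathPrimitive φ (s (i + 1)) - pathPrimitive φ (s i)) := by
      rw [Finset.sum_range_sub (fun i => pathPrimitive φ (s i)), hs]
      simp only [stoppedPt_two_pow, stoppedPt_zero]
      simp [pathPrimitive]
    have htel' : ∑ i ∈ Finset.range (2 ^ m), ((s (i + 1) : ℝ) - s i) ≤ 1 := by
      rw [Finset.sum_range_sub (fun i => (s i : ℝ)), hs]
      simp only [stoppedPt_two_pow, stoppedPt_zero]
      simpa using t.2.2
    rw [htel, Finset.mul_sum, ← Finset.sum_sub_distrib]
    calc |∑ i ∈ Finset.range (2 ^ m), (φ (s i) * (C * (s (i + 1) : ℝ) - C * (s i : ℝ))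
          - C * (pathPrimitive φ (s (i + 1)) - pathPrimitive φ (s i)))|
        ≤ ∑ i ∈ Finset.range (2 ^ m), C * (ε * ((s (i + 1) : ℝ) - s i)) := by
          refine (Finset.abs_sum_le_sum_abs _ _).trans (Finset.sum_le_sum fun i _ => ?_)
          have := abs_pathPrimitive_sub_le φ (a := s i) (b := s (i + 1))
            (stoppedPt_mono m t i.le_succ) (ε := ε) fun u hu1 hu2 => by
              refine (hφ (lt_of_le_of_lt ?_ (hs_dist i))).le
              have e1 : (s i : ℝ) ≤ u := hu1
              have e2 : (u : ℝ) ≤ s (i + 1) := hu2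
              rw [Subtype.dist_eq, Subtype.dist_eq, Real.dist_eq, Real.dist_eq,
                abs_of_nonneg (sub_nonneg.mpr e1), abs_of_nonneg (sub_nonneg.mpr (e1.trans e2))]
              exact sub_le_sub_right e2 _
          rw [show φ (s i) * (C * (s (i + 1) : ℝ) - C * (s i : ℝ))
              - C * (pathPrimitive φ (s (i + 1)) - pathPrimitive φ (s i))
              = -(C * (pathPrimitive φ (s (i + 1)) - pathPrimitive φ (s i)
                - φ (s i) * ((s (i + 1) : ℝ) - s i))) by ring, abs_neg, abs_mul, abs_of_nonneg hC]
          gcongr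
      _ = ε * C * ∑ i ∈ Finset.range (2 ^ m), ((s (i + 1) : ℝ) - s i) := by
          rw [Finset.mul_sum]
          exact Finset.sum_congr rfl fun i _ => by ring
      _ ≤ ε * C := mul_le_of_le_one_right (by positivity) htel'
  have hshift : ∀ᶠ l in atTop, dist (∑ j ∈ Finset.range (2 ^ (m + l)),
      φ (stoppedPt (m + l) j t) * |stoppedIncr x (m + l) j t| ^ p) (C * pathPrimitive φ t) < ε' := by
    filter_upwards [(hV t).eventually_lt_const (show C * (t : ℝ) < C + 1 by
        nlinarith [t.2.1, t.2.2]), Metric.tendsto_nhds.mp hmid ε hε] with l h1 h2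
    have h3 : |∑ j ∈ Finset.range (2 ^ (m + l)),
        φ (stoppedPt (m + l) j t) * |stoppedIncr x (m + l) j t| ^ p
        - ∑ i ∈ Finset.range (2 ^ m), φ (s i) *
          (discreteVariation p x (m + l) (s (i + 1)) - discreteVariation p x (m + l) (s i))|
        ≤ ε * discreteVariation p x (m + l) t := by
      rw [discreteVariation_eq_sum_stoppedIncr, pow_add, sum_range_mul_eq, sum_range_mul_eq,
        ← Finset.sum_sub_distrib, Finset.mul_sum]
      refine (Finset.abs_sum_le_sum_abs _ _).trans (Finset.sum_le_sum fun i hi => ?_)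
      rw [Finset.mem_range] at hi
      rw [hs, discreteVariation_stoppedPt hp x hi, discreteVariation_stoppedPt hp x hi.le,
        Nat.succ_mul, Finset.sum_range_add, add_sub_cancel_left, Finset.mul_sum,
        ← Finset.sum_sub_distrib, Finset.mul_sum]
      refine (Finset.abs_sum_le_sum_abs _ _).trans (Finset.sum_le_sum fun r hr => ?_)
      rw [Finset.mem_range] at hr
      rw [← sub_mul, abs_mul,
        abs_of_nonneg (by positivity : 0 ≤ |stoppedIncr x (m + l) (i * 2 ^ l + r) t| ^ p)]
      gcongr
      refine (hφ ?_).le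
      have h4 := dist_stoppedPt_le (m + l) (i * 2 ^ l) r t
      rw [show stoppedPt (m + l) (i * 2 ^ l) t = stoppedPt m i t by
        rw [stoppedPt, stoppedPt, dyadicPt_refine]] at h4
      refine (h4.trans ?_).trans_lt hm
      rw [div_le_iff₀ (by positivity), pow_add, ← mul_assoc, ← mul_pow]
      norm_num
      exact_mod_cast hr.le
    rw [Real.dist_eq] at h2 ⊢
    have h5 := abs_sub_le (∑ j ∈ Finset.range (2 ^ (m + l)),
        φ (stoppedPt (m + l) j t) * |stoppedIncr x (m + l) j t| ^ p) (∑ i ∈ Finset.range (2 ^ m), φ (s i) *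
          (discreteVariation p x (m + l) (s (i + 1)) - discreteVariation p x (m + l) (s i)))
          (C * pathPrimitive φ t)
    have h6 := abs_sub_le (∑ i ∈ Finset.range (2 ^ m), φ (s i) *
          (discreteVariation p x (m + l) (s (i + 1)) - discreteVariation p x (m + l) (s i)))
          (∑ i ∈ Finset.range (2 ^ m), φ (s i) * (C * (s (i + 1) : ℝ) - C * (s i : ℝ)))
          (C * pathPrimitive φ t)
    have h7 : ε * discreteVariation p x (m + l) t ≤ ε * (C + 1) := by gcongr
    linarith
  obtain ⟨N, hN⟩ := eventually_atTop.mp hshift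
  refine eventually_atTop.mpr ⟨m + N, fun n hn => ?_⟩
  obtain ⟨l, rfl⟩ := Nat.exists_eq_add_of_le (show m ≤ n by omega)
  exact hN l (by omega)

theorem stoppedIncr_mul (g x : C(unitInterval, ℝ)) (n j : ℕ) (t : unitInterval) :
    stoppedIncr (g * x) n j t
      = g (stoppedPt n j t) * stoppedIncr x n j t + x (stoppedPt n (j + 1) t) * stoppedIncr g n j t := by
  simp only [stoppedIncr, ContinuousMap.mul_apply]
  ring

/-- A factor `g` of vanishing `p`-th variation passes through the `p`-th variation as the weight
`|g| ^ p`. -/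
theorem tendsto_sum_abs_variation_mul_sub {p : ℕ} {g x : C(unitInterval, ℝ)} {t : unitInterval}
    {c : ℝ} (hx : Tendsto (fun n => discreteVariation p x n t) atTop (𝓝 c))
    (hg : Tendsto (fun n => discreteVariation p g n t) atTop (𝓝 0)) :
    Tendsto (fun n => ∑ j ∈ Finset.range (2 ^ n), |(|stoppedIncr (g * x) n j t| ^ p
      - |g (stoppedPt n j t)| ^ p * |stoppedIncr x n j t| ^ p)|) atTop (𝓝 0) := by
  have hbound : ∀ ε > 0, ∃ K, ∀ n, ∑ j ∈ Finset.range (2 ^ n), |(|stoppedIncr (g * x) n j t| ^ p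
      - |g (stoppedPt n j t)| ^ p * |stoppedIncr x n j t| ^ p)|
      ≤ ε * (‖g‖ ^ p * discreteVariation p x n t) + K * discreteVariation p g n t := by
    intro ε hε
    obtain ⟨K, hK, h⟩ := exists_abs_add_pow_sub_pow_le p hε
    refine ⟨K * ‖x‖ ^ p, fun n => ?_⟩
    rw [discreteVariation_eq_sum_stoppedIncr, discreteVariation_eq_sum_stoppedIncr, Finset.mul_sum,
      Finset.mul_sum, Finset.mul_sum, ← Finset.sum_add_distrib]
    refine Finset.sum_le_sum fun j _ => ?_
    rw [stoppedIncr_mul, ← mul_pow, ← abs_mul]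
    refine (h _ _).trans ?_
    rw [abs_mul, abs_mul, mul_pow, mul_pow, mul_assoc K]
    have h1 : |g (stoppedPt n j t)| ≤ ‖g‖ := g.norm_coe_le_norm _
    have h2 : |x (stoppedPt n (j + 1) t)| ≤ ‖x‖ := x.norm_coe_le_norm _
    gcongr
  rw [tendsto_order]
  refine ⟨fun a ha => Eventually.of_forall fun n =>
    ha.trans_le (Finset.sum_nonneg fun _ _ => abs_nonneg _), fun a ha => ?_⟩
  obtain ⟨ε, hε, hεa⟩ : ∃ ε > 0, ε * (‖g‖ ^ p * c) < a := by
    have hlim : Tendsto (fun ε : ℝ => ε * (‖g‖ ^ p * c)) (𝓝[>] 0) (𝓝 0) := by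
      have : Tendsto (fun ε : ℝ => ε * (‖g‖ ^ p * c)) (𝓝 0) (𝓝 (0 * (‖g‖ ^ p * c))) :=
        tendsto_id.mul_const _
      rw [zero_mul] at this
      exact this.mono_left nhdsWithin_le_nhds
    obtain ⟨ε, h1, h2⟩ := ((hlim.eventually_lt_const ha).and self_mem_nhdsWithin).exists
    exact ⟨ε, h2, h1⟩
  obtain ⟨K, hK⟩ := hbound ε hε
  have hlim : Tendsto (fun n => ε * (‖g‖ ^ p * discreteVariation p x n t)
      + K * discreteVariation p g n t) atTop (𝓝 (ε * (‖g‖ ^ p * c) + K * 0)) :=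
    ((hx.const_mul _).const_mul _).add (hg.const_mul _)
  rw [mul_zero, add_zero] at hlim
  filter_upwards [hlim.eventually_lt_const hεa] with n hn
  exact (hK n).trans_lt hn

theorem tendsto_sum_mul_variation_mul {p : ℕ} (hp : p ≠ 0) {g x : C(unitInterval, ℝ)} {C : ℝ}
    (hC : 0 ≤ C) (hx : HasPthVariation p x fun t => C * (t : ℝ))
    (hg : HasPthVariation p g fun _ => 0) (h : C(unitInterval, ℝ)) (t : unitInterval) :
    Tendsto (fun n => ∑ j ∈ Finset.range (2 ^ n),
      h (stoppedPt n j t) * |stoppedIncr (g * x) n j t| ^ p) atTop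
      (𝓝 (C * pathPrimitive (h * |g| ^ p) t)) := by
  have h1 := tendsto_sum_mul_variation hp hC hx (h * |g| ^ p) t
  have h2 : Tendsto (fun n => ∑ j ∈ Finset.range (2 ^ n), h (stoppedPt n j t) *
      (|stoppedIncr (g * x) n j t| ^ p
        - |g (stoppedPt n j t)| ^ p * |stoppedIncr x n j t| ^ p)) atTop (𝓝 0) := by
    have h3 := (tendsto_sum_abs_variation_mul_sub (hx.2 t) (hg.2 t)).const_mul ‖h‖
    rw [mul_zero] at h3
    refine squeeze_zero_norm (fun n => ?_) h3
    rw [Real.norm_eq_abs, Finset.mul_sum]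
    refine (Finset.abs_sum_le_sum_abs _ _).trans (Finset.sum_le_sum fun j _ => ?_)
    rw [abs_mul]
    gcongr
    exact h.norm_coe_le_norm _
  have h4 := h1.add h2
  rw [add_zero] at h4
  refine h4.congr fun n => ?_
  rw [← Finset.sum_add_distrib]
  refine Finset.sum_congr rfl fun j _ => ?_
  simp only [ContinuousMap.mul_apply, ContinuousMap.pow_apply, ContinuousMap.abs_apply]
  ring

/-! ### The change of variables formula -/

theorem follmerSum_eq_sum_stoppedIncr (p : ℕ) (f : ℝ → ℝ) (y : C(unitInterval, ℝ)) (n : ℕ)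
    (t : unitInterval) :
    follmerSum p f y n t = ∑ j ∈ Finset.range (2 ^ n), ∑ k ∈ Finset.Icc 1 (p - 1),
      iteratedDeriv k f (y (stoppedPt n j t)) / (k.factorial : ℝ) * stoppedIncr y n j t ^ k := by
  rw [follmerSum, Finset.sum_filter]
  refine Finset.sum_congr rfl fun j _ => ?_
  split_ifs with hj
  · rw [stoppedIncr, stoppedPt, stoppedPt, min_eq_left hj.le]
  · refine (Finset.sum_eq_zero fun k hk => ?_).symm
    rw [Finset.mem_Icc] at hk
    rw [stoppedIncr_eq_zero y (not_lt.mp hj), zero_pow (by omega), mul_zero]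

/-- The change of variables formula, for a path whose `p`-th variation converges when weighted by
`f⁽ᵖ⁾(y)`. -/
theorem tendsto_follmerSum {p : ℕ} (hp : 0 < p) (hp_even : Even p) {f : ℝ → ℝ}
    (hf : ContDiff ℝ p f) {y : C(unitInterval, ℝ)} {t : unitInterval} {c v : ℝ}
    (hy : Tendsto (fun n => discreteVariation p y n t) atTop (𝓝 c))
    (hv : Tendsto (fun n => ∑ j ∈ Finset.range (2 ^ n), iteratedDeriv p f (y (stoppedPt n j t)) *
      |stoppedIncr y n j t| ^ p) atTop (𝓝 v)) :
    Tendsto (fun n => follmerSum p f y n t) atTop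
      (𝓝 (f (y t) - f (y 0) - (p.factorial : ℝ)⁻¹ * v)) := by
  have herr : Tendsto (fun n => f (y t) - f (y 0) - follmerSum p f y n t
      - (p.factorial : ℝ)⁻¹ * ∑ j ∈ Finset.range (2 ^ n),
        iteratedDeriv p f (y (stoppedPt n j t)) * |stoppedIncr y n j t| ^ p) atTop (𝓝 0) := by
    rw [Metric.tendsto_nhds]
    intro ε hε
    have hc : 0 ≤ c := ge_of_tendsto' hy fun n =>
      Finset.sum_nonneg fun _ _ => by positivity
    obtain ⟨δ, hδ, hT⟩ := uniform_taylor_peano hp hf ‖y‖ (η := ε / (c + 1)) (by positivity)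
    filter_upwards [eventually_abs_stoppedIncr_lt y hδ,
      hy.eventually_lt_const (lt_add_one c)] with n h1 h2
    have htel : f (y t) - f (y 0) = ∑ j ∈ Finset.range (2 ^ n),
        (f (y (stoppedPt n (j + 1) t)) - f (y (stoppedPt n j t))) := by
      rw [Finset.sum_range_sub fun j => f (y (stoppedPt n j t)), stoppedPt_two_pow, stoppedPt_zero]
    rw [Real.dist_eq, sub_zero, htel, follmerSum_eq_sum_stoppedIncr, Finset.mul_sum,
      ← Finset.sum_sub_distrib, ← Finset.sum_sub_distrib]
    calc _ ≤ ∑ j ∈ Finset.range (2 ^ n), ε / (c + 1) * |stoppedIncr y n j t| ^ p := by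
          refine (Finset.abs_sum_le_sum_abs _ _).trans (Finset.sum_le_sum fun j _ => ?_)
          have hmem : ∀ s, y s ∈ Set.Icc (-‖y‖) ‖y‖ := fun s => abs_le.mp (y.norm_coe_le_norm s)
          have := hT _ (hmem (stoppedPt n j t)) _ (hmem (stoppedPt n (j + 1) t)) (h1 j t)
          refine le_trans (le_of_eq ?_) this
          -- As `p` is even, the Taylor term of order `p` carries `|Δy| ^ p`.
          rw [hp_even.pow_abs, stoppedIncr]
          congr 1
          ring
      _ = ε / (c + 1) * discreteVariation p y n t := (Finset.mul_sum _ _ _).symm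
      _ < ε / (c + 1) * (c + 1) := by gcongr
      _ = ε := by field_simp
  have h := (tendsto_const_nhds (x := f (y t) - f (y 0))).sub
    (herr.add (hv.const_mul (p.factorial : ℝ)⁻¹))
  rw [zero_add] at h
  exact h.congr fun n => by ring

/-- The path `t ↦ f (y t) - f (y 0) - (C / p!) * ∫₀ᵗ d(y) * |g| ^ p` with `y = g * x`; the continuous
function `d` stands for the derivative of `f` of order `p`. -/
noncomputable def itoPath (f d : C(ℝ, ℝ)) (p : ℕ) (C : ℝ) (x g : C(unitInterval, ℝ)) :
    C(unitInterval, ℝ) :=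
  f.comp (g * x) - ContinuousMap.const unitInterval (f (g 0 * x 0))
    - ((p.factorial : ℝ)⁻¹ * C) • pathPrimitive (d.comp (g * x) * |g| ^ p)

theorem continuous_itoPath (f d : C(ℝ, ℝ)) (p : ℕ) (C : ℝ) (x : C(unitInterval, ℝ)) :
    Continuous (itoPath f d p C x) := by
  have hcomp : ∀ e : C(ℝ, ℝ), Continuous fun g : C(unitInterval, ℝ) => e.comp (g * x) := fun e =>
    (ContinuousMap.continuous_postcomp e).comp (continuous_id.mul continuous_const)
  have habs : Continuous fun g : C(unitInterval, ℝ) => |g| :=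
    ContinuousMap.continuous_postcomp (⟨abs, continuous_abs⟩ : C(ℝ, ℝ))
  have hprod : Continuous fun g : C(unitInterval, ℝ) => d.comp (g * x) * |g| ^ p :=
    (hcomp d).mul (habs.pow p)
  have hconst : Continuous fun g : C(unitInterval, ℝ) =>
      ContinuousMap.const unitInterval (f (g 0 * x 0)) :=
    ContinuousMap.continuous_const'.comp
      (f.continuous.comp ((continuous_eval_const (0 : unitInterval)).mul continuous_const))
  have hprim : Continuous fun g : C(unitInterval, ℝ) =>
      pathPrimitive (d.comp (g * x) * |g| ^ p) := continuous_pathPrimitive.comp hprod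
  exact ((hcomp f).sub hconst).sub
    ((continuous_const_smul ((p.factorial : ℝ)⁻¹ * C)).comp hprim)

theorem isFollmerItoIntegral_itoPath {p : ℕ} (hp : 0 < p) (hp_even : Even p) {f : ℝ → ℝ}
    (hf : ContDiff ℝ p f) {g x : C(unitInterval, ℝ)} {C : ℝ}
    (hC : 0 ≤ C) (hx : HasPthVariation p x fun t => C * (t : ℝ))
    (hg : HasPthVariation p g fun _ => 0) :
    IsFollmerItoIntegral p f (g * x) (itoPath ⟨f, hf.continuous⟩
      ⟨iteratedDeriv p f, hf.continuous_iteratedDeriv p le_rfl⟩ p C x g) := by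
  intro t
  have hy := tendsto_sum_mul_variation_mul hp.ne' hC hx hg 1 t
  simp only [ContinuousMap.one_apply, one_mul] at hy
  have hv := tendsto_sum_mul_variation_mul hp.ne' hC hx hg
    ((⟨iteratedDeriv p f, hf.continuous_iteratedDeriv p le_rfl⟩ : C(ℝ, ℝ)).comp (g * x)) t
  have h := tendsto_follmerSum hp hp_even hf hy hv
  rw [← mul_assoc] at h
  exact h

theorem discreteVariation_add_const (p : ℕ) (x : C(unitInterval, ℝ)) (M : ℝ) (n : ℕ)
    (t : unitInterval) :
    discreteVariation p (x + ContinuousMap.const unitInterval M) n t = discreteVariation p x n t := by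
  simp [discreteVariation]

/-- `B` is a Banach space of continuous functions through the inclusion `ι`; `xb = x + M` is the
positive shift of the path `x` with linear `p`-th variation. -/
theorem theorem3p15 {B : Type*} [NormedAddCommGroup B] [NormedSpace ℝ B] [CompleteSpace B]
    (p : ℕ) (hp : 1 < p) (hp_even : Even p)
    (x : C(unitInterval, ℝ)) (Cp : ℝ) (hCp : 0 < Cp)
    (hx : HasPthVariation p x (fun t => Cp * (t : ℝ)))
    (M : ℝ) (hM : ‖x‖ < M)
    (xb : C(unitInterval, ℝ)) (hxb : xb = x + ContinuousMap.const unitInterval M)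
    (ι : B →ₗ[ℝ] C(unitInterval, ℝ)) (hι : Function.Injective ι)
    (hB : ∀ g : B, HasPthVariation p (ι g) (fun _ => 0))
    (hC : ∃ K : ℝ, ∀ g : B, ‖ι g‖ ≤ K * ‖g‖)
    (hLp : ∃ K : ℝ, ∀ g : B,
      (∫ t : unitInterval, |ι g t| ^ p) ^ (1 / (p : ℝ)) ≤ K * ‖g‖)
    (f : ℝ → ℝ) (hf : ContDiff ℝ (p : WithTop ℕ∞) f) :
    ∃ I : transportedSpace ι xb → C(unitInterval, ℝ),
      (∀ y : transportedSpace ι xb, IsFollmerItoIntegral p f (y : C(unitInterval, ℝ)) (I y)) ∧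
      ∀ y : transportedSpace ι xb, ∀ ε > 0, ∃ δ > 0, ∀ z : transportedSpace ι xb,
        transportedNorm ι xb (z - y) < δ → ‖I z - I y‖ < ε := by
  have hpos : ∀ t, 0 < xb t := fun t => by
    have h := (abs_le.mp (x.norm_coe_le_norm t)).1
    rw [hxb, ContinuousMap.add_apply, ContinuousMap.const_apply]
    linarith
  have hxb_var : HasPthVariation p xb fun t => Cp * (t : ℝ) := by
    refine ⟨hx.1, fun t => ?_⟩
    simpa only [hxb, discreteVariation_add_const] using hx.2 t
  obtain ⟨K, hK⟩ := hC
  have hι_cont : Continuous ι := AddMonoidHomClass.continuous_of_bound ι K hK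
  choose G hG using fun y : transportedSpace ι xb => LinearMap.mem_range.mp y.2
  set J : C(unitInterval, ℝ) → C(unitInterval, ℝ) := itoPath ⟨f, hf.continuous⟩
    ⟨iteratedDeriv p f, hf.continuous_iteratedDeriv p le_rfl⟩ p Cp xb with hJ
  refine ⟨fun y => J (ι (G y)), fun y => ?_, fun y ε hε => ?_⟩
  · have h := isFollmerItoIntegral_itoPath (by omega) hp_even hf hCp.le hxb_var (hB (G y))
    rwa [show ι (G y) * xb = (y : C(unitInterval, ℝ)) from hG y] at h
  · have hcont : Continuous fun g : B => J (ι g) := (continuous_itoPath _ _ _ _ _).comp hι_cont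
    obtain ⟨δ, hδ, h⟩ := Metric.continuous_iff.mp hcont (G y) ε hε
    refine ⟨δ, hδ, fun z hz => ?_⟩
    rw [← dist_eq_norm]
    refine h (G z) ?_
    rw [dist_eq_norm, ← transportedNorm_eq hι hpos (z - y) (G z - G y)]
    · exact hz
    · have hz' : ι (G z) * xb = (z : C(unitInterval, ℝ)) := hG z
      have hy' : ι (G y) * xb = (y : C(unitInterval, ℝ)) := hG y
      rw [map_sub, sub_mul, hz', hy', Submodule.coe_sub]
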